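/- Let $T>0$, let $\alpha\in(1/2,1]$, and let $x:[0,T]\to\mathbb{R}^\ell$ be an $\alpha$-Hölder continuous path. Let $L(\mathbb{R}^\ell,\mathbb{R}^d)$ be the space of linear maps from $\mathbb{R}^\ell$ to $\mathbb{R}^d$ with the operator norm, and equip the set $\mathcal{K}(L(\mathbb{R}^\ell,\mathbb{R}^d))$ of its nonempty compact subsets with the Hausdorff metric. Let $\gamma\in(\frac1\alpha-1,1)$ and let $F:\mathbb{R}^d\to\mathcal{K}(L(\mathbb{R}^\ell,\mathbb{R}^d))$ be $\gamma$-Hölder continuous and bounded, that is, $\sup_{a\in\mathbb{R}^d}\sup_{A\in F(a)}\|A\|<\infty$. Then for every $\xi\in\mathbb{R}^d$ the Young differential inclusion $dz_t\in F(z_t)\,dx_t$, $z_0=\xi$, has a solution on $[0,T]$: there are paths $z:[0,T]\to\mathbb{R}^d$ and $v:[0,T]\to L(\mathbb{R}^\ell,\mathbb{R}^d)$ such that 1. for some $p\ge 1$ with $\alpha+\frac1p>1$, $v$ has finite $p$-variation on $[0,T]$, that is, $\sup\sum_i\|v_{s_{i+1}}-v_{s_i}\|^p<\infty$, the supremum being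 over all finite partitions $\{s_i\}$ of $[0,T]$ ($v$ need not be continuous); 2. for every $t\in[0,T]$, $v_t\in F(z_t)$ and $z_t=\xi+\int_0^t v_s\,dx_s$, where the integral is a Young integral: the Riemann sums $\sum_i v_{s_i}(x_{s_{i+1}}-x_{s_i})$ over finite partitions $\{s_i\}$ of $[0,t]$ converge to $\int_0^t v_s\,dx_s$ as the mesh of the partition tends to $0$. -/

import Mathlib

open scoped NNReal

namespace YoungInclusion

/-- The points `u 0 ≤ u 1 ≤ … ≤ u n` form a finite partition of the interval `[a, b]`.
The values `u i` for `i > n` play no role. -/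
def IsPartition (a b : ℝ) (n : ℕ) (u : ℕ → ℝ) : Prop :=
  u 0 = a ∧ u n = b ∧ ∀ i < n, u i ≤ u (i + 1)

/-- `y` has finite `p`-variation over `[a, b]`: the sums `∑ |y (u (i+1)) - y (u i)| ^ p`, taken over
all finite partitions of `[a, b]`, have a finite supremum. -/
def HasFinitePVariation {G : Type*} [NormedAddCommGroup G] (p : ℝ) (y : ℝ → G) (a b : ℝ) : Prop :=
  ∃ C : ℝ, ∀ (n : ℕ) (u : ℕ → ℝ), IsPartition a b n u →
    ∑ i ∈ Finset.range n, ‖y (u (i + 1)) - y (u i)‖ ^ p ≤ C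

/-- The left-point Riemann sum of `v` against `x` along the points `u 0, …, u n`. -/
def riemannSum {E G : Type*} [NormedAddCommGroup E] [NormedSpace ℝ E]
    [NormedAddCommGroup G] [NormedSpace ℝ G]
    (v : ℝ → E →L[ℝ] G) (x : ℝ → E) (n : ℕ) (u : ℕ → ℝ) : G :=
  ∑ i ∈ Finset.range n, v (u i) (x (u (i + 1)) - x (u i))

/-- `I` is the Young integral of `v` against `x` over `[a, b]`: the Riemann sums along finite
partitions of `[a, b]` converge to `I` as the mesh of the partition tends to `0`. -/
def IsYoungIntegral {E G : Type*} [NormedAddCommGroup E] [NormedSpace ℝ E]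
    [NormedAddCommGroup G] [NormedSpace ℝ G]
    (v : ℝ → E →L[ℝ] G) (x : ℝ → E) (a b : ℝ) (I : G) : Prop :=
  ∀ ε > (0 : ℝ), ∃ δ > (0 : ℝ), ∀ (n : ℕ) (u : ℕ → ℝ), IsPartition a b n u →
    (∀ i < n, u (i + 1) - u i ≤ δ) → ‖riemannSum v x n u - I‖ ≤ ε

/-- `(z, v)` is a solution on `[0, T]` of the Young differential inclusion
`dz ∈ F(z) dx`, `z 0 = ξ`, driven by an `α`-Hölder path `x`. Only the values of `x`, `z` and `v`
on `[0, T]` matter. -/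
structure IsSolution {E G : Type*} [NormedAddCommGroup E] [NormedSpace ℝ E]
    [NormedAddCommGroup G] [NormedSpace ℝ G]
    (α T : ℝ) (x : ℝ → E) (F : G → Set (E →L[ℝ] G)) (ξ : G)
    (z : ℝ → G) (v : ℝ → E →L[ℝ] G) : Prop where
  finite_variation : ∃ p : ℝ, 1 ≤ p ∧ 1 < α + 1 / p ∧ HasFinitePVariation p v 0 T
  mem : ∀ t ∈ Set.Icc 0 T, v t ∈ F (z t)
  integral : ∀ t ∈ Set.Icc 0 T, ∃ I : G, IsYoungIntegral v x 0 t I ∧ z t = ξ + I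

end YoungInclusion

/-! Run an Euler scheme on the dyadic grid of mesh `1 / 2 ^ N`, and choose `v` at `(2k+1)2^r` in `F
(z ..)` as close as possible, up to the Hölder bound, to its value at `2k·2^r` (`exists_euler`).
Then `v` at level `n + 1` differs from its value at the level-`n` parent by at most `C * b ^ n`,
where `a = 2 ^ (-α)` and `b = a ^ γ`, although `v` itself may jump.

As in the sewing lemma, the error of `z` against `v dx` on a cell obeys a recursion from fine to
coarse levels. It closes with the bound `Λ * (a * b) ^ n` because `2 * (a * b) = 2 ^ (1 - α * (1 +
γ)) < 1`. The constants do not depend on `N`: `Λ` grows like `K ^ γ` with the step constant `K`, and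
`γ < 1` lets `K` dominate (`exists_dyadicScheme_le`, `exists_add_mul_rpow_le`). Compactness in
finite dimension gives a scheme on all levels.

Geometric decay extends `z` and `v` to real times as limits along `⌊2 ^ n * t⌋₊`. Approximation of
`v` by dyadic step functions at rate `b ^ n` gives finite `p`-variation for `p * α * γ > 1`. It also
gives the Young integral directly: passing from level `n` to `n + 1` changes every Riemann sum by
`O((2 * (a * b)) ^ n)`, uniformly in the partition. -/

namespace YoungInclusion

open Finset Filter Topology

/-! ### Riemann sums of dyadic step functions -/

section Partition

variable {E G : Type*} [NormedAddCommGroup E] [NormedSpace ℝ E]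
  [NormedAddCommGroup G] [NormedSpace ℝ G]

theorem le_of_step_le {n : ℕ} {u : ℕ → ℝ} (hu : ∀ i < n, u i ≤ u (i + 1)) {i j : ℕ}
    (hij : i ≤ j) (hj : j ≤ n) : u i ≤ u j := by
  induction j, hij using Nat.le_induction with
  | base => exact le_rfl
  | succ j hij ih => exact (ih (by omega)).trans (hu j (by omega))

theorem IsPartition.mem_Icc {a b : ℝ} {n : ℕ} {u : ℕ → ℝ} (h : IsPartition a b n u) {i : ℕ}
    (hi : i ≤ n) : u i ∈ Set.Icc a b := by
  obtain ⟨rfl, rfl, hu⟩ := h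
  exact ⟨le_of_step_le hu (Nat.zero_le i) hi, le_of_step_le hu hi le_rfl⟩

/-- The first of the points `u 0 ≤ … ≤ u n` that is at least `c`, or `u n` if there is none. -/
noncomputable def firstPoint (n : ℕ) (u : ℕ → ℝ) (c : ℝ) : ℝ :=
  u 0 + ∑ i ∈ range n, if u i < c then u (i + 1) - u i else 0

theorem firstPoint_succ_of_lt {n : ℕ} {u : ℕ → ℝ} (hu : ∀ i < n + 1, u i ≤ u (i + 1)) {c : ℝ}
    (h : u n < c) : firstPoint (n + 1) u c = u (n + 1) := by
  have : ∑ i ∈ range (n + 1), (if u i < c then u (i + 1) - u i else 0) =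
      ∑ i ∈ range (n + 1), (u (i + 1) - u i) := by
    refine sum_congr rfl fun i hi => if_pos ?_
    exact (le_of_step_le hu (Nat.lt_succ_iff.1 (mem_range.1 hi)) (Nat.le_succ n)).trans_lt h
  rw [firstPoint, this, sum_range_sub]
  ring

theorem firstPoint_succ_of_le {n : ℕ} {u : ℕ → ℝ} {c : ℝ} (h : c ≤ u n) :
    firstPoint (n + 1) u c = firstPoint n u c := by
  rw [firstPoint, sum_range_succ, if_neg h.not_gt, add_zero, firstPoint]

/-- The points are sorted, so the indices with `u i < c` form an initial segment and the sum
telescopes. -/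
theorem sum_ite_lt_eq {A : Type*} [AddCommGroup A] (x : ℝ → A) {n : ℕ} {u : ℕ → ℝ} (hu : ∀ i < n, u i ≤ u (i + 1)) (c : ℝ) :
    ∑ i ∈ range n, (if u i < c then x (u (i + 1)) - x (u i) else 0) =
      x (firstPoint n u c) - x (u 0) := by
  induction n with
  | zero => simp [firstPoint]
  | succ n ih =>
    rcases lt_or_ge (u n) c with h | h
    · rw [firstPoint_succ_of_lt hu h, ← sum_range_sub (fun i => x (u i))]
      refine sum_congr rfl fun i hi => if_pos ?_
      exact (le_of_step_le hu (Nat.lt_succ_iff.1 (mem_range.1 hi)) (Nat.le_succ n)).trans_lt h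
    · rw [firstPoint_succ_of_le h, sum_range_succ, if_neg h.not_gt, add_zero,
        ih fun i hi => hu i (by omega)]

theorem firstPoint_mono {n : ℕ} {u : ℕ → ℝ} (hu : ∀ i < n, u i ≤ u (i + 1)) :
    Monotone (firstPoint n u) := by
  intro c c' hc
  refine add_le_add le_rfl (sum_le_sum fun i hi => ?_)
  have := hu i (mem_range.1 hi)
  split_ifs <;> linarith

theorem firstPoint_of_lt {n : ℕ} {u : ℕ → ℝ} (hu : ∀ i < n, u i ≤ u (i + 1)) {c : ℝ}
    (hc : u n < c) : firstPoint n u c = u n := by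
  cases n with
  | zero => simp [firstPoint]
  | succ n => exact firstPoint_succ_of_lt hu ((hu n (by omega)).trans_lt hc)

theorem firstPoint_le {n : ℕ} {u : ℕ → ℝ} (hu : ∀ i < n, u i ≤ u (i + 1)) (c : ℝ) :
    firstPoint n u c ≤ u n := by
  rw [← firstPoint_of_lt hu (lt_of_lt_of_le (lt_add_one (u n)) (le_max_right c _))]
  exact firstPoint_mono hu (le_max_left _ _)

theorem firstPoint_of_le_zero {n : ℕ} {u : ℕ → ℝ} (hu : ∀ i < n, u i ≤ u (i + 1)) {c : ℝ}
    (hc : c ≤ u 0) : firstPoint n u c = u 0 := by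
  rw [firstPoint, sum_eq_zero fun i hi => if_neg ?_, add_zero]
  exact (hc.trans (le_of_step_le hu (Nat.zero_le i) (mem_range.1 hi).le)).not_gt

theorem min_le_firstPoint {n : ℕ} {u : ℕ → ℝ} (hu : ∀ i < n, u i ≤ u (i + 1)) (c : ℝ) :
    min c (u n) ≤ firstPoint n u c := by
  induction n with
  | zero => simp [firstPoint]
  | succ n ih =>
    rcases lt_or_ge (u n) c with h | h
    · rw [firstPoint_succ_of_lt hu h]
      exact min_le_right _ _
    · rw [firstPoint_succ_of_le h]
      refine le_trans ?_ (ih fun i hi => hu i (by omega))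
      rw [min_eq_left h]
      exact min_le_left _ _

theorem firstPoint_le_add {n : ℕ} {u : ℕ → ℝ} (hu : ∀ i < n, u i ≤ u (i + 1)) {c δ : ℝ}
    (hδ : 0 ≤ δ) (hc : u 0 ≤ c) (hm : ∀ i < n, u (i + 1) - u i ≤ δ) :
    firstPoint n u c ≤ c + δ := by
  induction n with
  | zero => simpa [firstPoint] using hc.trans (le_add_of_nonneg_right hδ)
  | succ n ih =>
    rcases lt_or_ge (u n) c with h | h
    · rw [firstPoint_succ_of_lt hu h]
      linarith [hm n (by omega)]
    · rw [firstPoint_succ_of_le h]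
      exact ih (fun i hi => hu i (by omega)) fun i hi => hm i (by omega)

theorem abs_firstPoint_sub_min_le {n : ℕ} {u : ℕ → ℝ} (hu : ∀ i < n, u i ≤ u (i + 1)) {c δ : ℝ}
    (hδ : 0 ≤ δ) (hc : u 0 ≤ c) (hm : ∀ i < n, u (i + 1) - u i ≤ δ) :
    |firstPoint n u c - min c (u n)| ≤ δ := by
  have h₁ := min_le_firstPoint hu c
  have h₂ := firstPoint_le_add hu hδ hc hm
  have h₃ := firstPoint_le hu c
  rw [abs_of_nonneg (by linarith)]
  rcases min_cases c (u n) with ⟨h, -⟩ | ⟨h, -⟩ <;> rw [h] <;> linarith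

/-- The Riemann sum of a dyadic step function collapses to a sum over the dyadic cells. -/
theorem riemannSum_dyadicStep (w : ℕ → E →L[ℝ] G) (x : ℝ → E) (m J : ℕ) {t : ℝ} {n : ℕ}
    {u : ℕ → ℝ} (hu : IsPartition 0 t n u) (hJ : t < J / 2 ^ m) :
    riemannSum (fun s => w ⌊2 ^ m * s⌋₊) x n u =
      ∑ c ∈ range J, w c (x (firstPoint n u ((c + 1 : ℕ) / 2 ^ m)) -
        x (firstPoint n u (c / 2 ^ m))) := by
  -- The partition points lying in cell `c` are consecutive, so their increments add up to one
  -- increment between first points.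
  have key : ∀ c : ℕ, x (firstPoint n u ((c + 1 : ℕ) / 2 ^ m)) - x (firstPoint n u (c / 2 ^ m)) =
      ∑ i ∈ range n, if ⌊2 ^ m * u i⌋₊ = c then x (u (i + 1)) - x (u i) else 0 := by
    intro c
    rw [← sub_sub_sub_cancel_right _ _ (x (u 0)), ← sum_ite_lt_eq x hu.2.2,
      ← sum_ite_lt_eq x hu.2.2, ← sum_sub_distrib]
    refine sum_congr rfl fun i hi => ?_
    have h0 : (0 : ℝ) ≤ 2 ^ m * u i :=
      mul_nonneg (by positivity) (hu.mem_Icc (mem_range.1 hi).le).1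
    have h2 : (0 : ℝ) < 2 ^ m := by positivity
    have e₁ : u i < (c + 1 : ℕ) / 2 ^ m ↔ ⌊2 ^ m * u i⌋₊ < c + 1 := by
      rw [Nat.floor_lt h0, lt_div_iff₀ h2, mul_comm]
    have e₂ : u i < (c : ℝ) / 2 ^ m ↔ ⌊2 ^ m * u i⌋₊ < c := by
      rw [Nat.floor_lt h0, lt_div_iff₀ h2, mul_comm]
    simp only [e₁, e₂]
    split_ifs <;> first | omega | simp
  simp only [key, map_sum]
  rw [sum_comm, riemannSum]
  refine sum_congr rfl fun i hi => ?_
  have hlt : ⌊2 ^ m * u i⌋₊ < J := by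
    have := hu.mem_Icc (mem_range.1 hi).le
    rw [Nat.floor_lt (mul_nonneg (by positivity) this.1)]
    rw [lt_div_iff₀ (by positivity)] at hJ
    have h2 : (0 : ℝ) < 2 ^ m := by positivity
    nlinarith [this.2]
  rw [sum_eq_single_of_mem _ (mem_range.2 hlt) fun c _ hc => by rw [if_neg hc.symm, map_zero],
    if_pos rfl]

end Partition

/-- Being affine in `y`, the right side can be summed over cells by telescoping; this replaces
Hölder's inequality for `∑ y ^ α`. -/
theorem rpow_le_tangent {y δ α : ℝ} (hy : 0 ≤ y) (hδ : 0 < δ) (hα : 0 ≤ α) (hα1 : α ≤ 1) :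
    y ^ α ≤ δ ^ α * (1 + y / δ) := by
  have hd : 0 < δ ^ α := Real.rpow_pos_of_pos hδ α
  have hq : 0 ≤ y / δ := by positivity
  have e : y ^ α = δ ^ α * (y / δ) ^ α := by
    rw [← Real.mul_rpow hδ.le hq, mul_div_cancel₀ _ hδ.ne']
  rw [e]
  refine mul_le_mul_of_nonneg_left ?_ hd.le
  rcases le_total (y / δ) 1 with h | h
  · linarith [Real.rpow_le_one hq h hα]
  · have := Real.rpow_le_rpow_of_exponent_le h hα1
    rw [Real.rpow_one] at this
    linarith

/-- Dyadic scaling: `((2 ^ n)⁻¹) ^ α = (2 ^ (-α)) ^ n`. -/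
theorem inv_two_pow_rpow (α : ℝ) (n : ℕ) : (1 / 2 ^ n : ℝ) ^ α = ((2 : ℝ) ^ (-α)) ^ n := by
  rw [one_div, Real.inv_rpow (by positivity), Real.rpow_neg (by positivity), inv_pow,
    ← Real.rpow_natCast, ← Real.rpow_natCast, ← Real.rpow_mul (by positivity),
    ← Real.rpow_mul (by positivity), mul_comm]

/-! ### Partition-independent bound and small-mesh limit for step functions -/

section StepBounds

variable {E G : Type*} [NormedAddCommGroup E] [NormedSpace ℝ E]
  [NormedAddCommGroup G] [NormedSpace ℝ G]

/-- However fine the partition, only about `2 ^ m * t` cells contribute, each with an increment of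
`x` of order `2 ^ (-α * m)` on average. The bound is therefore uniform in the partition. -/
theorem norm_riemannSum_dyadicStep_le {w : ℕ → E →L[ℝ] G} {x : ℝ → E} {H α B : ℝ}
    (hα : 0 ≤ α) (hα1 : α ≤ 1) (hH : 0 ≤ H)
    (hx : ∀ s t, ‖x t - x s‖ ≤ H * |t - s| ^ α) (hw : ∀ c, ‖w c‖ ≤ B)
    (m : ℕ) {t : ℝ} (ht : 0 ≤ t) {n : ℕ} {u : ℕ → ℝ} (hu : IsPartition 0 t n u) :
    ‖riemannSum (fun s => w ⌊2 ^ m * s⌋₊) x n u‖ ≤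
      B * H * (2 * t + 1) * (2 * (2 : ℝ) ^ (-α)) ^ m := by
  set r := fun c : ℕ => firstPoint n u (c / 2 ^ m) with hr
  set J := ⌊2 ^ m * t⌋₊ + 1 with hJdef
  have h2 : (1 : ℝ) ≤ 2 ^ m := one_le_pow₀ (by norm_num)
  have hB : 0 ≤ B := (norm_nonneg _).trans (hw 0)
  have hJ : t < J / 2 ^ m := by
    rw [lt_div_iff₀ (by positivity), mul_comm, hJdef]
    push_cast
    exact Nat.lt_floor_add_one (2 ^ m * t)
  have hJ' : (J : ℝ) ≤ 2 ^ m * t + 1 := by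
    have := Nat.floor_le (show 0 ≤ 2 ^ m * t by positivity)
    rw [hJdef]; push_cast; linarith
  have hrm : ∀ c, r c ≤ r (c + 1) := fun c =>
    firstPoint_mono hu.2.2 (div_le_div_of_nonneg_right (by push_cast; linarith) (by positivity))
  set a := (2 : ℝ) ^ (-α) with ha
  have ha0 : 0 < a := by positivity
  have step : ∀ c ∈ range J, ‖w c (x (r (c + 1)) - x (r c))‖ ≤
      B * H * (a ^ m * (1 + 2 ^ m * (r (c + 1) - r c))) := by
    intro c _
    have hy : 0 ≤ r (c + 1) - r c := sub_nonneg.2 (hrm c)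
    calc _ ≤ ‖w c‖ * ‖x (r (c + 1)) - x (r c)‖ := (w c).le_opNorm _
      _ ≤ B * (H * |r (c + 1) - r c| ^ α) :=
          mul_le_mul (hw c) (hx _ _) (norm_nonneg _) hB
      _ ≤ _ := by
          rw [abs_of_nonneg hy, mul_assoc]
          refine mul_le_mul_of_nonneg_left (mul_le_mul_of_nonneg_left ?_ hH) hB
          have := rpow_le_tangent (δ := 1 / 2 ^ m) hy (by positivity) hα hα1
          rw [inv_two_pow_rpow] at this
          simpa [mul_comm] using this
  rw [riemannSum_dyadicStep w x m J hu hJ]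
  refine (norm_sum_le_of_le _ step).trans ?_
  rw [← mul_sum, ← mul_sum, sum_add_distrib, ← mul_sum, sum_range_sub, sum_const, card_range,
    nsmul_eq_mul, mul_one, mul_pow]
  have e1 : r J = t := (firstPoint_of_lt hu.2.2 (hu.2.1.trans_lt hJ)).trans hu.2.1
  have e0 : r 0 = 0 := (firstPoint_of_le_zero hu.2.2 (by simp [hu.1])).trans hu.1
  rw [e1, e0, sub_zero, mul_assoc (B * H)]
  refine mul_le_mul_of_nonneg_left ?_ (mul_nonneg hB hH)
  have : (J : ℝ) + 2 ^ m * t ≤ (2 * t + 1) * 2 ^ m := by nlinarith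
  calc a ^ m * (J + 2 ^ m * t) ≤ a ^ m * ((2 * t + 1) * 2 ^ m) :=
        mul_le_mul_of_nonneg_left this (by positivity)
    _ = _ := by ring

/-- After collapsing to cells, each first point is within the mesh `δ` of the cell endpoint cut off
at `t`; two such errors arise per cell. -/
theorem norm_riemannSum_dyadicStep_sub_le {w : ℕ → E →L[ℝ] G} {x : ℝ → E} {H α B : ℝ}
    (hα : 0 ≤ α) (hH : 0 ≤ H)
    (hx : ∀ s t, ‖x t - x s‖ ≤ H * |t - s| ^ α) (hw : ∀ c, ‖w c‖ ≤ B)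
    (m J : ℕ) {t : ℝ} (hJ : t < J / 2 ^ m) {n : ℕ} {u : ℕ → ℝ} (hu : IsPartition 0 t n u)
    {δ : ℝ} (hδ : 0 ≤ δ) (hm : ∀ i < n, u (i + 1) - u i ≤ δ) :
    ‖riemannSum (fun s => w ⌊2 ^ m * s⌋₊) x n u -
      ∑ c ∈ range J, w c (x (min ((c + 1 : ℕ) / 2 ^ m) t) - x (min (c / 2 ^ m) t))‖ ≤
      J * (2 * B * H) * δ ^ α := by
  have hB : 0 ≤ B := (norm_nonneg _).trans (hw 0)
  have hclose : ∀ c : ℕ, ‖x (firstPoint n u (c / 2 ^ m)) - x (min (c / 2 ^ m) t)‖ ≤ H * δ ^ α := by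
    intro c
    refine (hx _ _).trans (mul_le_mul_of_nonneg_left ?_ hH)
    refine Real.rpow_le_rpow (abs_nonneg _) ?_ hα
    have := abs_firstPoint_sub_min_le hu.2.2 (c := c / 2 ^ m) hδ (by rw [hu.1]; positivity) hm
    rwa [hu.2.1] at this
  rw [riemannSum_dyadicStep w x m J hu hJ, ← sum_sub_distrib]
  refine (norm_sum_le_of_le (f := _) (n := fun _ => 2 * B * H * δ ^ α) _ fun c _ => ?_).trans ?_
  · rw [← map_sub]
    refine ((w c).le_opNorm _).trans ?_
    have e : ∀ p q p' q' : E, p - q - (p' - q') = (p - p') - (q - q') := fun p q p' q' => by abel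
    have : ‖x (firstPoint n u ((c + 1 : ℕ) / 2 ^ m)) - x (firstPoint n u (c / 2 ^ m)) -
        (x (min ((c + 1 : ℕ) / 2 ^ m) t) - x (min (c / 2 ^ m) t))‖ ≤ H * δ ^ α + H * δ ^ α := by
      rw [e]
      exact (norm_sub_le _ _).trans (add_le_add (hclose (c + 1)) (hclose c))
    calc _ ≤ B * (H * δ ^ α + H * δ ^ α) := mul_le_mul (hw c) this (norm_nonneg _) hB
      _ = _ := by ring
  · rw [sum_const, card_range, nsmul_eq_mul, ← mul_assoc]

end StepBounds

/-! ### Construction of the dyadic scheme -/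

section Scheme

variable {E G : Type*} [NormedAddCommGroup E] [NormedSpace ℝ E]
  [NormedAddCommGroup G] [NormedSpace ℝ G]

/-- Paths `z` and `v` on the dyadic numbers, `z n k` standing for the value at `k / 2 ^ n`, that
solve the inclusion `dz ∈ F(z) dx` up to errors of the order `(a * b) ^ n` on the dyadic intervals
of the levels `n ∈ L`. -/
structure IsDyadicScheme (x : ℝ → E) (F : G → Set (E →L[ℝ] G)) (ξ : G) (a b C Λ K : ℝ)
    (L : Set ℕ) (z : ℕ → ℕ → G) (v : ℕ → ℕ → E →L[ℝ] G) : Prop where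
  start : ∀ n ∈ L, z n 0 = ξ
  mem : ∀ n ∈ L, ∀ k, v n k ∈ F (z n k)
  z_even : ∀ n, n + 1 ∈ L → ∀ k, z (n + 1) (2 * k) = z n k
  v_even : ∀ n, n + 1 ∈ L → ∀ k, v (n + 1) (2 * k) = v n k
  v_odd : ∀ n, n + 1 ∈ L → ∀ k, ‖v (n + 1) (2 * k + 1) - v n k‖ ≤ C * b ^ n
  defect : ∀ n ∈ L, ∀ k, ‖z n (k + 1) - z n k -
    v n k (x ((k + 1 : ℕ) / 2 ^ n) - x (k / 2 ^ n))‖ ≤ Λ * (a * b) ^ n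
  z_step : ∀ n ∈ L, ∀ k, ‖z n (k + 1) - z n k‖ ≤ K * a ^ n

/-- Choice along a strong recursion: the Euler scheme needs the previous value and also one possibly
far back. -/
theorem exists_of_forall_history {X : Type*} {R : (n : ℕ) → ((m : ℕ) → m < n → X) → X → Prop}
    (h : ∀ n g, ∃ y, R n g y) : ∃ f : ℕ → X, ∀ n, R n (fun m _ => f m) (f n) := by
  choose s hs using h
  refine ⟨Nat.lt_wfRel.wf.fix s, fun n => ?_⟩
  have := hs n fun m _ => Nat.lt_wfRel.wf.fix s m
  rwa [WellFounded.fix_eq]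

/-- The Euler scheme in which the value of `v` at `(2 * k + 1) * 2 ^ r` is selected close to the
one at `2 * k * 2 ^ r`. -/
theorem exists_euler {F : G → Set (E →L[ℝ] G)} {CF γ : ℝ} (hne : ∀ p, (F p).Nonempty)
    (hsel : ∀ p, ∀ A ∈ F p, ∀ q, ∃ B ∈ F q, ‖B - A‖ ≤ CF * ‖q - p‖ ^ γ) (ξ : G) (X : ℕ → E) :
    ∃ (z : ℕ → G) (v : ℕ → E →L[ℝ] G), z 0 = ξ ∧ (∀ j, v j ∈ F (z j)) ∧
      (∀ j, z (j + 1) = z j + v j (X (j + 1) - X j)) ∧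
      ∀ k r, ‖v ((2 * k + 1) * 2 ^ r) - v (2 * k * 2 ^ r)‖ ≤
        CF * ‖z ((2 * k + 1) * 2 ^ r) - z (2 * k * 2 ^ r)‖ ^ γ := by
  -- Subtracting the largest power of two that divides an index clears its lowest binary digit `1`,
  -- sending `(2k+1)2^r` to `2k·2^r`.
  have hlt : ∀ n, n + 1 - 2 ^ padicValNat 2 (n + 1) < n + 1 := fun n =>
    Nat.sub_lt (Nat.succ_pos n) (by positivity)
  obtain ⟨f, hf⟩ := exists_of_forall_history (X := {p : G × (E →L[ℝ] G) // p.2 ∈ F p.1})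
    (R := fun n => match n with
      | 0 => fun _ y => y.1.1 = ξ
      | n + 1 => fun g y =>
        y.1.1 = (g n n.lt_succ_self).1.1 + (g n n.lt_succ_self).1.2 (X (n + 1) - X n) ∧
        ‖y.1.2 - (g _ (hlt n)).1.2‖ ≤ CF * ‖y.1.1 - (g _ (hlt n)).1.1‖ ^ γ) (by
      intro n g
      cases n with
      | zero => exact ⟨⟨(ξ, (hne ξ).some), (hne ξ).some_mem⟩, rfl⟩
      | succ n =>
        obtain ⟨B, hB, hBA⟩ := hsel _ _ (g _ (hlt n)).2
          ((g n n.lt_succ_self).1.1 + (g n n.lt_succ_self).1.2 (X (n + 1) - X n))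
        exact ⟨⟨(_, B), hB⟩, rfl, hBA⟩)
  refine ⟨fun j => (f j).1.1, fun j => (f j).1.2, hf 0, fun j => (f j).2,
    fun j => (hf (j + 1)).1, fun k r => ?_⟩
  obtain ⟨n, hn⟩ : ∃ n, (2 * k + 1) * 2 ^ r = n + 1 :=
    Nat.exists_eq_succ_of_ne_zero (by positivity)
  have hval : padicValNat 2 (n + 1) = r := by
    rw [← hn, padicValNat.mul (by omega) (by positivity), padicValNat.prime_pow,
      padicValNat.eq_zero_of_not_dvd (by omega), zero_add]
  have hpa : n + 1 - 2 ^ padicValNat 2 (n + 1) = 2 * k * 2 ^ r := by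
    rw [hval, ← hn, add_mul, one_mul, Nat.add_sub_cancel]
  have := (hf (n + 1)).2
  simp only [hpa] at this
  rwa [hn]

/-- The levels `n ≤ N` are samples of one Euler scheme of mesh `1 / 2 ^ N`. Hypothesis `hΛ` closes
the recursion for the defect, and `hK` recovers the step bound from the defect. -/
theorem exists_dyadicScheme_le {x : ℝ → E} {F : G → Set (E →L[ℝ] G)} {CF γ α H M C Λ K b : ℝ}
    (hγ : 0 ≤ γ) (hCF : 0 ≤ CF) (hα : 0 ≤ α) (hM : 0 ≤ M)
    (hne : ∀ p, (F p).Nonempty) (hbd : ∀ p, ∀ A ∈ F p, ‖A‖ ≤ M)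
    (hsel : ∀ p, ∀ A ∈ F p, ∀ q, ∃ B ∈ F q, ‖B - A‖ ≤ CF * ‖q - p‖ ^ γ)
    (hx : ∀ s t, ‖x t - x s‖ ≤ H * |t - s| ^ α)
    (hb : b = ((2 : ℝ) ^ (-α)) ^ γ) (hK0 : 0 ≤ K)
    (hC : C = CF * (K * (2 : ℝ) ^ (-α)) ^ γ) (hΛ0 : 0 ≤ Λ)
    (hΛ : 2 * Λ * ((2 : ℝ) ^ (-α) * b) + C * H * (2 : ℝ) ^ (-α) ≤ Λ)
    (hK : M * H + Λ ≤ K) (ξ : G) (N : ℕ) :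
    ∃ z v, IsDyadicScheme x F ξ ((2 : ℝ) ^ (-α)) b C Λ K (Set.Iic N) z v := by
  set a := (2 : ℝ) ^ (-α) with ha
  have ha0 : 0 < a := by positivity
  have hb0 : 0 < b := hb ▸ Real.rpow_pos_of_pos ha0 γ
  have ha1 : a ≤ 1 := Real.rpow_le_one_of_one_le_of_nonpos (by norm_num) (by linarith)
  have hb1 : b ≤ 1 := hb ▸ Real.rpow_le_one ha0.le ha1 hγ
  have hC0 : 0 ≤ C := hC ▸ by positivity
  obtain ⟨Z, V, hZ0, hmem, hZ, hodd⟩ := exists_euler hne hsel ξ fun j => x (j / 2 ^ N)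
  have hxs : ∀ n k : ℕ, ‖x ((k + 1 : ℕ) / 2 ^ n) - x (k / 2 ^ n)‖ ≤ H * a ^ n := by
    intro n k
    refine (hx _ _).trans_eq ?_
    rw [ha, ← inv_two_pow_rpow, ← sub_div, Nat.cast_succ, add_sub_cancel_left,
      abs_of_pos (by positivity)]
  have hdbl : ∀ n, n + 1 ≤ N → ∀ k, 2 * k * 2 ^ (N - (n + 1)) = k * 2 ^ (N - n) := by
    intro n hn k
    rw [show N - n = N - (n + 1) + 1 by omega]
    ring
  set z : ℕ → ℕ → G := fun n k => Z (k * 2 ^ (N - n)) with hz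
  set v : ℕ → ℕ → E →L[ℝ] G := fun n k => V (k * 2 ^ (N - n)) with hv
  have z_even : ∀ n, n + 1 ≤ N → ∀ k, z (n + 1) (2 * k) = z n k := fun n hn k => by
    simp only [hz, hdbl n hn]
  have v_even : ∀ n, n + 1 ≤ N → ∀ k, v (n + 1) (2 * k) = v n k := fun n hn k => by
    simp only [hv, hdbl n hn]
  have z_step : ∀ n k, ‖z n (k + 1) - z n k -
      v n k (x ((k + 1 : ℕ) / 2 ^ n) - x (k / 2 ^ n))‖ ≤ Λ * (a * b) ^ n →
      ‖z n (k + 1) - z n k‖ ≤ K * a ^ n := by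
    intro n k h
    have h₁ : ‖v n k (x ((k + 1 : ℕ) / 2 ^ n) - x (k / 2 ^ n))‖ ≤ M * (H * a ^ n) :=
      ((v n k).le_opNorm _).trans
        (mul_le_mul (hbd _ _ (hmem _)) (hxs n k) (norm_nonneg _) hM)
    have h₂ : (a * b) ^ n ≤ a ^ n := by
      rw [mul_pow]
      exact mul_le_of_le_one_right (by positivity) (pow_le_one₀ hb0.le hb1)
    calc _ ≤ _ := norm_le_norm_sub_add _ (v n k (x ((k + 1 : ℕ) / 2 ^ n) - x (k / 2 ^ n)))
      _ ≤ Λ * a ^ n + M * (H * a ^ n) :=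
          add_le_add (h.trans (mul_le_mul_of_nonneg_left h₂ hΛ0)) h₁
      _ = (M * H + Λ) * a ^ n := by ring
      _ ≤ K * a ^ n := mul_le_mul_of_nonneg_right hK (by positivity)
  have v_odd_of : ∀ n, n + 1 ≤ N → (∀ k, ‖z (n + 1) (k + 1) - z (n + 1) k‖ ≤ K * a ^ (n + 1)) →
      ∀ k, ‖v (n + 1) (2 * k + 1) - v n k‖ ≤ C * b ^ n := by
    intro n hn h k
    rw [← v_even n hn]
    refine (hodd k (N - (n + 1))).trans ?_
    rw [hC, mul_assoc CF]
    refine mul_le_mul_of_nonneg_left ?_ hCF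
    refine (Real.rpow_le_rpow (norm_nonneg _) (h (2 * k)) hγ).trans_eq ?_
    rw [hb, pow_succ', ← mul_assoc, Real.mul_rpow (by positivity) (by positivity),
      ← Real.rpow_natCast, ← Real.rpow_natCast, ← Real.rpow_mul ha0.le, ← Real.rpow_mul ha0.le,
      mul_comm (n : ℝ)]
  -- Induction on `i = N - n`, from fine to coarse: at level `N` the Euler step is exact, so the
  -- defect vanishes.
  have defect : ∀ i n, n + i = N → ∀ k, ‖z n (k + 1) - z n k -
      v n k (x ((k + 1 : ℕ) / 2 ^ n) - x (k / 2 ^ n))‖ ≤ Λ * (a * b) ^ n := by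
    intro i
    induction i with
    | zero =>
      rintro n rfl k
      simp only [hz, hv, add_zero, Nat.sub_self, pow_zero, mul_one, hZ]
      rw [add_sub_cancel_left, sub_self, norm_zero]
      positivity
    | succ i ih =>
      intro n hn k
      have hn' : n + 1 ≤ N := by omega
      have hD := ih (n + 1) (by omega)
      have h₃ := v_odd_of n hn' (fun k => z_step _ _ (hD k)) k
      have h₁ := hD (2 * k)
      have h₂ := hD (2 * k + 1)
      have hx₂ := hxs (n + 1) (2 * k + 1)
      have e : ∀ j : ℕ, ((2 * j : ℕ) : ℝ) / 2 ^ (n + 1) = j / 2 ^ n := by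
        intro j
        push_cast
        rw [pow_succ']
        exact mul_div_mul_left _ _ (by norm_num)
      rw [z_even n hn', v_even n hn', e] at h₁
      rw [show 2 * k + 1 + 1 = 2 * (k + 1) by ring, z_even n hn', e] at h₂
      rw [show 2 * k + 1 + 1 = 2 * (k + 1) by ring, e] at hx₂
      set z₁ := z (n + 1) (2 * k + 1)
      set v₁ := v (n + 1) (2 * k + 1)
      set x₀ := x (k / 2 ^ n)
      set x₁ := x ((2 * k + 1 : ℕ) / 2 ^ (n + 1))
      set x₂ := x ((k + 1 : ℕ) / 2 ^ n)
      -- The defect of a cell is the sum of those of its halves plus the change of `v` at the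
      -- midpoint applied to the second increment of `x`.
      have hsplit : z n (k + 1) - z n k - v n k (x₂ - x₀) =
          (z₁ - z n k - v n k (x₁ - x₀)) + (z n (k + 1) - z₁ - v₁ (x₂ - x₁)) +
            (v₁ - v n k) (x₂ - x₁) := by
        simp only [map_sub, sub_apply]
        abel
      have h₄ : ‖(v₁ - v n k) (x₂ - x₁)‖ ≤ C * b ^ n * (H * a ^ (n + 1)) :=
        ((v₁ - v n k).le_opNorm _).trans (mul_le_mul h₃ hx₂ (norm_nonneg _) (by positivity))
      rw [hsplit]
      calc _ ≤ Λ * (a * b) ^ (n + 1) + Λ * (a * b) ^ (n + 1) + C * b ^ n * (H * a ^ (n + 1)) :=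
            norm_add_le_of_le (norm_add_le_of_le h₁ h₂) h₄
        _ = (2 * Λ * (a * b) + C * H * a) * (a * b) ^ n := by ring
        _ ≤ _ := mul_le_mul_of_nonneg_right hΛ (by positivity)
  have defect' : ∀ n ≤ N, ∀ k, ‖z n (k + 1) - z n k -
      v n k (x ((k + 1 : ℕ) / 2 ^ n) - x (k / 2 ^ n))‖ ≤ Λ * (a * b) ^ n := fun n hn =>
    defect (N - n) n (by omega)
  exact ⟨z, v, {
    start := fun n _ => by simp only [hz, zero_mul, hZ0]
    mem := fun n _ k => hmem _
    z_even := z_even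
    v_even := v_even
    v_odd := fun n hn => v_odd_of n hn fun k => z_step _ _ (defect' _ hn k)
    defect := defect'
    z_step := fun n hn k => z_step _ _ (defect' _ hn k) }⟩

/-- A set-valued map that allows Hölder selections between pairs of points has a closed graph. -/
theorem mem_of_tendsto_graph {F : G → Set (E →L[ℝ] G)} {CF γ : ℝ} (hγ : 0 < γ)
    (hcl : ∀ p, IsClosed (F p))
    (hsel : ∀ p, ∀ A ∈ F p, ∀ q, ∃ B ∈ F q, ‖B - A‖ ≤ CF * ‖q - p‖ ^ γ)
    {ι : Type*} {l : Filter ι} [l.NeBot] {z : ι → G} {v : ι → E →L[ℝ] G} {p : G} {A : E →L[ℝ] G}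
    (hz : Tendsto z l (𝓝 p)) (hv : Tendsto v l (𝓝 A)) (h : ∀ᶠ i in l, v i ∈ F (z i)) :
    A ∈ F p := by
  have h' : ∀ i, ∃ B, v i ∈ F (z i) → B ∈ F p ∧ ‖B - v i‖ ≤ CF * ‖p - z i‖ ^ γ := fun i => by
    by_cases hi : v i ∈ F (z i)
    · obtain ⟨B, hB, hB'⟩ := hsel _ _ hi p
      exact ⟨B, fun _ => ⟨hB, hB'⟩⟩
    · exact ⟨0, fun hi' => absurd hi' hi⟩
  choose B hB using h'
  have h0 : Tendsto (fun i => CF * ‖p - z i‖ ^ γ) l (𝓝 0) := by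
    have := ((tendsto_const_nhds (x := p)).sub hz).norm.rpow_const (p := γ) (Or.inr hγ.le)
    simpa [Real.zero_rpow hγ.ne'] using this.const_mul CF
  have hBv : Tendsto (fun i => B i - v i) l (𝓝 0) :=
    squeeze_zero_norm' (h.mono fun i hi => (hB i hi).2) h0
  have hBA : Tendsto B l (𝓝 A) := by simpa using hBv.add hv
  exact (hcl p).mem_of_tendsto hBA (h.mono fun i hi => (hB i hi).1)

theorem exists_tendsto_ultrafilter {X ι : Type*} [NormedAddCommGroup X] [ProperSpace X]
    (l : Ultrafilter ι) {f : ι → X} {R : ℝ} (h : ∀ᶠ i in (l : Filter ι), ‖f i‖ ≤ R) :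
    ∃ y, Tendsto f l (𝓝 y) := by
  obtain ⟨y, -, hy⟩ := (isCompact_closedBall (0 : X) R).ultrafilter_le_nhds' (l.map f)
    (Ultrafilter.mem_map.2 (mem_of_superset h fun i hi => mem_closedBall_zero_iff.2 hi))
  exact ⟨y, hy⟩

/-- Schemes on the levels up to `N` have a limit as `N` tends to infinity. -/
theorem exists_dyadicScheme_of_forall_le [ProperSpace G] [ProperSpace (E →L[ℝ] G)]
    {x : ℝ → E} {F : G → Set (E →L[ℝ] G)} {ξ : G} {CF γ M a b C Λ K : ℝ} (hγ : 0 < γ)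
    (hcl : ∀ p, IsClosed (F p)) (hbd : ∀ p, ∀ A ∈ F p, ‖A‖ ≤ M)
    (hsel : ∀ p, ∀ A ∈ F p, ∀ q, ∃ B ∈ F q, ‖B - A‖ ≤ CF * ‖q - p‖ ^ γ)
    (h : ∀ N : ℕ, ∃ z v, IsDyadicScheme x F ξ a b C Λ K (Set.Iic N) z v) :
    ∃ z v, IsDyadicScheme x F ξ a b C Λ K Set.univ z v := by
  choose Z V hZV using h
  -- One ultrafilter gives convergence at all dyadic points at once, without a diagonal subsequence.
  set l : Ultrafilter ℕ := hyperfilter ℕ with hl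
  have hev : ∀ n, ∀ᶠ N in (l : Filter ℕ), n ∈ Set.Iic N := fun n =>
    (Nat.hyperfilter_le_atTop : (l : Filter ℕ) ≤ atTop) (eventually_ge_atTop n)
  have hzlim : ∀ n k, ∃ y, Tendsto (fun N => Z N n k) l (𝓝 y) := by
    intro n k
    refine exists_tendsto_ultrafilter l (R := ‖ξ‖ + k * (K * a ^ n)) ((hev n).mono fun N hN => ?_)
    induction k with
    | zero => simp [(hZV N).start n hN]
    | succ k ih =>
      have := norm_le_norm_add_norm_sub' (Z N n (k + 1)) (Z N n k)
      have := (hZV N).z_step n hN k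
      push_cast
      linarith
  have hvlim : ∀ n k, ∃ y, Tendsto (fun N => V N n k) l (𝓝 y) := fun n k =>
    exists_tendsto_ultrafilter l (R := M)
      ((hev n).mono fun N hN => hbd _ _ ((hZV N).mem n hN k))
  choose z hz using hzlim
  choose v hv using hvlim
  refine ⟨z, v, ?_, ?_, ?_, ?_, ?_, ?_, ?_⟩
  · intro n _
    exact tendsto_nhds_unique_of_eventuallyEq (hz n 0) tendsto_const_nhds
      ((hev n).mono fun N hN => (hZV N).start n hN)
  · intro n _ k
    exact mem_of_tendsto_graph hγ hcl hsel (hz n k) (hv n k)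
      ((hev n).mono fun N hN => (hZV N).mem n hN k)
  · intro n _ k
    exact tendsto_nhds_unique_of_eventuallyEq (hz _ _) (hz n k)
      ((hev (n + 1)).mono fun N hN => (hZV N).z_even n hN k)
  · intro n _ k
    exact tendsto_nhds_unique_of_eventuallyEq (hv _ _) (hv n k)
      ((hev (n + 1)).mono fun N hN => (hZV N).v_even n hN k)
  · intro n _ k
    exact le_of_tendsto ((hv _ _).sub (hv n k)).norm
      ((hev (n + 1)).mono fun N hN => (hZV N).v_odd n hN k)
  · intro n _ k
    have happ : Tendsto (fun N => V N n k (x ((k + 1 : ℕ) / 2 ^ n) - x (k / 2 ^ n))) l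
        (𝓝 (v n k (x ((k + 1 : ℕ) / 2 ^ n) - x (k / 2 ^ n)))) :=
      ((ContinuousLinearMap.apply ℝ G _).continuous.tendsto _).comp (hv n k)
    exact le_of_tendsto (((hz n (k + 1)).sub (hz n k)).sub happ).norm
      ((hev n).mono fun N hN => (hZV N).defect n hN k)
  · intro n _ k
    exact le_of_tendsto ((hz n (k + 1)).sub (hz n k)).norm
      ((hev n).mono fun N hN => (hZV N).z_step n hN k)

/-- Since `γ < 1`, the term `c * K ^ γ` is sublinear; any `K ≥ 1` with `K ^ (1 - γ) ≥ c₀ + c` works.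
-/
theorem exists_add_mul_rpow_le {c₀ c γ : ℝ} (h₀ : 0 ≤ c₀) (hγ : 0 ≤ γ) (hγ1 : γ < 1) :
    ∃ K : ℝ, 0 ≤ K ∧ c₀ + c * K ^ γ ≤ K := by
  obtain ⟨K, hK1, hK⟩ := (((tendsto_rpow_atTop (sub_pos.2 hγ1)).eventually_ge_atTop
    (c₀ + c)).and (eventually_ge_atTop 1)).exists
  have hK0 : 0 < K := by linarith
  refine ⟨K, hK0.le, ?_⟩
  have h1 : 1 ≤ K ^ γ := Real.one_le_rpow hK hγ
  calc c₀ + c * K ^ γ ≤ (c₀ + c) * K ^ γ := by nlinarith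
    _ ≤ K ^ (1 - γ) * K ^ γ := mul_le_mul_of_nonneg_right hK1 (by positivity)
    _ = K := by rw [← Real.rpow_add hK0]; simp

theorem exists_dyadicScheme [ProperSpace G] [ProperSpace (E →L[ℝ] G)]
    {x : ℝ → E} {F : G → Set (E →L[ℝ] G)} {CF γ α H M : ℝ}
    (hγ : 0 < γ) (hγ1 : γ < 1) (hαγ : 1 < α * (1 + γ))
    (hCF : 0 ≤ CF) (hα : 0 ≤ α) (hH : 0 ≤ H) (hM : 0 ≤ M)
    (hne : ∀ p, (F p).Nonempty) (hcl : ∀ p, IsClosed (F p)) (hbd : ∀ p, ∀ A ∈ F p, ‖A‖ ≤ M)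
    (hsel : ∀ p, ∀ A ∈ F p, ∀ q, ∃ B ∈ F q, ‖B - A‖ ≤ CF * ‖q - p‖ ^ γ)
    (hx : ∀ s t, ‖x t - x s‖ ≤ H * |t - s| ^ α) (ξ : G) :
    ∃ C Λ K z v, 0 ≤ C ∧ 0 ≤ Λ ∧ 0 ≤ K ∧
      IsDyadicScheme x F ξ ((2 : ℝ) ^ (-α)) ((2 : ℝ) ^ (-(α * γ))) C Λ K Set.univ z v := by
  set a := (2 : ℝ) ^ (-α) with ha
  set b := (2 : ℝ) ^ (-(α * γ)) with hb
  have ha0 : 0 < a := by positivity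
  have hb0 : 0 < b := by positivity
  have hba : b = a ^ γ := by rw [hb, ha, ← Real.rpow_mul (by norm_num), neg_mul]
  have hab : 0 < 1 - 2 * (a * b) := by
    have : 2 * (a * b) = (2 : ℝ) ^ (1 - α * (1 + γ)) := by
      rw [ha, hb, ← Real.rpow_add (by norm_num)]
      nth_rw 1 [← Real.rpow_one 2]
      rw [← Real.rpow_add (by norm_num)]
      congr 1
      ring
    rw [this, sub_pos]
    exact Real.rpow_lt_one_of_one_lt_of_neg (by norm_num) (by linarith)
  -- With `Λ` defined below by equality in its recursion, `M * H + Λ ≤ K` becomes this inequality,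
  -- since `(K * a) ^ γ = K ^ γ * b`.
  obtain ⟨K, hK0, hK⟩ := exists_add_mul_rpow_le (c₀ := M * H)
    (c := CF * b * H * a / (1 - 2 * (a * b))) (mul_nonneg hM hH) hγ.le hγ1
  have hC0 : 0 ≤ CF * (K * a) ^ γ := by positivity
  obtain ⟨Λ, hΛ⟩ : ∃ Λ, Λ = CF * (K * a) ^ γ * H * a / (1 - 2 * (a * b)) := ⟨_, rfl⟩
  have hΛ0 : 0 ≤ Λ := hΛ ▸ by positivity
  have hΛ' : Λ * (1 - 2 * (a * b)) = CF * (K * a) ^ γ * H * a := by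
    rw [hΛ, div_mul_cancel₀ _ hab.ne']
  have hΛK : M * H + Λ ≤ K := by
    refine le_trans (le_of_eq ?_) hK
    rw [hΛ, Real.mul_rpow hK0 ha0.le, ← hba]
    ring
  obtain ⟨z, v, h⟩ := exists_dyadicScheme_of_forall_le (ξ := ξ) hγ hcl hbd hsel fun N =>
    exists_dyadicScheme_le hγ.le hCF hα hM hne hbd hsel hx hba hK0 rfl hΛ0
      (by rw [← ha]; linarith) hΛK ξ N
  exact ⟨_, _, K, z, v, hC0, hΛ0, hK0, h⟩

end Scheme

/-! ### Passage to real times: `p`-variation and Young integral -/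

section Limit

variable {E G : Type*} [NormedAddCommGroup E] [NormedSpace ℝ E]
  [NormedAddCommGroup G] [NormedSpace ℝ G]

theorem floor_two_pow_mul (n : ℕ) (t : ℝ) : ⌊2 ^ n * t⌋₊ = ⌊2 ^ (n + 1) * t⌋₊ / 2 := by
  have := Nat.floor_div_natCast (2 ^ (n + 1) * t) 2
  rw [← this]
  congr 1
  push_cast
  ring

/-- A family of functions on the dyadic numbers whose refinements decay geometrically extends to a
function on the real line. -/
theorem exists_dyadic_extension {X : Type*} [NormedAddCommGroup X] [CompleteSpace X]
    {f : ℕ → ℕ → X} {B r : ℝ} (hr : r < 1)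
    (hf : ∀ n j, ‖f (n + 1) j - f n (j / 2)‖ ≤ B * r ^ n) :
    ∃ g : ℝ → X, ∀ t, (∀ n, ‖f n ⌊2 ^ n * t⌋₊ - g t‖ ≤ B * r ^ n / (1 - r)) ∧
      Tendsto (fun n => f n ⌊2 ^ n * t⌋₊) atTop (𝓝 (g t)) := by
  have hu : ∀ t : ℝ, ∀ n, dist (f n ⌊2 ^ n * t⌋₊) (f (n + 1) ⌊2 ^ (n + 1) * t⌋₊) ≤ B * r ^ n := by
    intro t n
    rw [dist_comm, dist_eq_norm, floor_two_pow_mul n t]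
    exact hf n _
  choose g hg using fun t => cauchySeq_tendsto_of_complete (cauchySeq_of_le_geometric r B hr (hu t))
  refine ⟨g, fun t => ⟨fun n => ?_, hg t⟩⟩
  rw [← dist_eq_norm]
  exact dist_le_of_le_geometric_of_tendsto r B hr (hu t) (hg t) n

theorem HasFinitePVariation.of_le_sub {X : Type*} [NormedAddCommGroup X] {y : ℝ → X} {p T : ℝ}
    (Φ : ℝ → ℝ) (h : ∀ s t, 0 ≤ s → s ≤ t → ‖y t - y s‖ ^ p ≤ Φ t - Φ s) :
    HasFinitePVariation p y 0 T := by
  refine ⟨Φ T - Φ 0, fun n u hu => ?_⟩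
  have : ∑ i ∈ range n, (Φ (u (i + 1)) - Φ (u i)) = Φ T - Φ 0 := by
    rw [sum_range_sub fun i => Φ (u i), hu.1, hu.2.1]
  rw [← this]
  refine sum_le_sum fun i hi => ?_
  have hi := mem_range.1 hi
  exact h _ _ (hu.mem_Icc hi.le).1 (hu.2.2 i hi)

/-- A bounded function at distance `B * b ^ n` from a step function on the dyadic cells of level `n`
has finite `p`-variation as soon as `2 * b ^ p < 1`. -/
theorem hasFinitePVariation_of_dyadic_approx {X : Type*} [NormedAddCommGroup X] {y : ℝ → X}
    {f : ℕ → ℕ → X} {B b M p T : ℝ} (hb : 0 < b) (hb1 : b < 1) (hB : 0 ≤ B) (hp : 0 ≤ p)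
    (hbp : 2 * b ^ p < 1)
    (hM : ∀ t, ‖y t‖ ≤ M) (hf : ∀ t n, ‖f n ⌊2 ^ n * t⌋₊ - y t‖ ≤ B * b ^ n) :
    HasFinitePVariation p y 0 T := by
  have hM0 : 0 ≤ M := (norm_nonneg _).trans (hM 0)
  -- The term `2 * M` serves points already separated at level `0`; `2 * B / b` pays for using the
  -- last common level, one below the first separating one.
  set Q := 2 * M + 2 * B / b with hQ
  have hQ0 : 0 ≤ Q := by positivity
  have hbp0 : 0 < b ^ p := Real.rpow_pos_of_pos hb p
  have hsum : ∀ t : ℝ, 0 ≤ t → Summable fun n : ℕ => (b ^ p) ^ n * (⌊2 ^ n * t⌋₊ : ℝ) := by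
    intro t ht
    refine Summable.of_nonneg_of_le (fun n => by positivity) (fun n => ?_)
      ((summable_geometric_of_lt_one (by positivity) hbp).mul_left t)
    calc _ ≤ (b ^ p) ^ n * (2 ^ n * t) :=
          mul_le_mul_of_nonneg_left (Nat.floor_le (by positivity)) (by positivity)
      _ = _ := by rw [mul_pow]; ring
  -- The control function: points separated at level `n` raise its `n`-th term by at least `(b ^ p)
  -- ^ n`. It is finite because the floor is at most `2 ^ n * t` and `2 * b ^ p < 1`.
  refine HasFinitePVariation.of_le_sub
    (fun t => Q ^ p * ∑' n : ℕ, (b ^ p) ^ n * (⌊2 ^ n * t⌋₊ : ℝ)) fun s t hs hst => ?_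
  have hmono : ∀ n : ℕ, ⌊2 ^ n * s⌋₊ ≤ ⌊2 ^ n * t⌋₊ := fun n =>
    Nat.floor_mono (mul_le_mul_of_nonneg_left hst (by positivity))
  have hdiff := (hsum t (hs.trans hst)).sub (hsum s hs)
  have hnonneg : ∀ n : ℕ, 0 ≤ (b ^ p) ^ n * (⌊2 ^ n * t⌋₊ : ℝ) -
      (b ^ p) ^ n * (⌊2 ^ n * s⌋₊ : ℝ) := fun n =>
    sub_nonneg.2 (mul_le_mul_of_nonneg_left (by exact_mod_cast hmono n) (by positivity))
  rw [← mul_sub, ← (hsum t (hs.trans hst)).tsum_sub (hsum s hs)]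
  have hsame : ∀ n : ℕ, ⌊2 ^ n * s⌋₊ = ⌊2 ^ n * t⌋₊ → ‖y t - y s‖ ≤ 2 * B * b ^ n := by
    intro n hn
    have h₁ := hf t n
    have h₂ := hf s n
    rw [hn] at h₂
    calc _ = ‖(f n ⌊2 ^ n * t⌋₊ - y s) - (f n ⌊2 ^ n * t⌋₊ - y t)‖ := by congr 1; abel
      _ ≤ B * b ^ n + B * b ^ n := norm_sub_le_of_le h₂ h₁
      _ = _ := by ring
  by_cases hall : ∀ n : ℕ, ⌊2 ^ n * s⌋₊ = ⌊2 ^ n * t⌋₊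
  · have h0 : ‖y t - y s‖ ≤ 0 := by
      refine ge_of_tendsto' (x := atTop) ?_ fun n => hsame n (hall n)
      simpa using (tendsto_pow_atTop_nhds_zero_of_lt_one hb.le hb1).const_mul (2 * B)
    rw [le_antisymm h0 (norm_nonneg _)]
    simp only [hall, sub_self, tsum_zero, mul_zero]
    -- For `p = 0` the power `0 ^ 0` would be `1`, but `hbp` rules this case out.
    rcases hp.eq_or_lt with rfl | hp
    · norm_num at hbp
    · exact (Real.zero_rpow hp.ne').le
  · push Not at hall
    classical
    obtain ⟨n, hn, hmin⟩ : ∃ n : ℕ, ⌊2 ^ n * s⌋₊ ≠ ⌊2 ^ n * t⌋₊ ∧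
        ∀ m < n, ⌊2 ^ m * s⌋₊ = ⌊2 ^ m * t⌋₊ :=
      ⟨Nat.find hall, Nat.find_spec hall, fun m hm => not_not.1 (Nat.find_min hall hm)⟩
    have hyn : ‖y t - y s‖ ≤ Q * b ^ n := by
      cases n with
      | zero =>
        have := norm_sub_le_of_le (hM t) (hM s)
        have : 0 ≤ 2 * B / b := by positivity
        rw [pow_zero, mul_one]
        linarith
      | succ n =>
        refine (hsame n (hmin n n.lt_succ_self)).trans ?_
        have : Q * b ^ (n + 1) = 2 * M * b ^ (n + 1) + 2 * B * b ^ n := by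
          rw [hQ, pow_succ]
          field_simp
        rw [this]
        exact le_add_of_nonneg_left (by positivity)
    have hone : (1 : ℝ) ≤ (⌊2 ^ n * t⌋₊ : ℝ) - ⌊2 ^ n * s⌋₊ := by
      have : ⌊2 ^ n * s⌋₊ + 1 ≤ ⌊2 ^ n * t⌋₊ := lt_of_le_of_ne (hmono n) hn
      have : ((⌊2 ^ n * s⌋₊ + 1 : ℕ) : ℝ) ≤ ⌊2 ^ n * t⌋₊ := by exact_mod_cast this
      push_cast at this
      linarith
    calc ‖y t - y s‖ ^ p ≤ (Q * b ^ n) ^ p := Real.rpow_le_rpow (norm_nonneg _) hyn hp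
      _ = Q ^ p * (b ^ p) ^ n := by
          rw [Real.mul_rpow hQ0 (by positivity), ← Real.rpow_natCast, ← Real.rpow_natCast,
            ← Real.rpow_mul hb.le, ← Real.rpow_mul hb.le, mul_comm (n : ℝ)]
      _ ≤ Q ^ p * ((b ^ p) ^ n * (⌊2 ^ n * t⌋₊ : ℝ) - (b ^ p) ^ n * (⌊2 ^ n * s⌋₊ : ℝ)) := by
          refine mul_le_mul_of_nonneg_left ?_ (by positivity)
          rw [← mul_sub]
          exact le_mul_of_one_le_right (by positivity) hone
      _ ≤ _ := mul_le_mul_of_nonneg_left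
          (hdiff.le_tsum n fun m _ => hnonneg m) (by positivity)

namespace IsDyadicScheme

variable {x : ℝ → E} {F : G → Set (E →L[ℝ] G)} {ξ : G} {a b C Λ K : ℝ}
  {z : ℕ → ℕ → G} {v : ℕ → ℕ → E →L[ℝ] G}

theorem v_refine (h : IsDyadicScheme x F ξ a b C Λ K Set.univ z v) (hC : 0 ≤ C) (hb : 0 ≤ b)
    (n j : ℕ) : ‖v (n + 1) j - v n (j / 2)‖ ≤ C * b ^ n := by
  obtain ⟨k, rfl | rfl⟩ := j.even_or_odd'
  · rw [Nat.mul_div_cancel_left _ two_pos, h.v_even n trivial, sub_self, norm_zero]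
    positivity
  · rw [show (2 * k + 1) / 2 = k by omega]
    exact h.v_odd n trivial k

theorem z_refine (h : IsDyadicScheme x F ξ a b C Λ K Set.univ z v) (hK : 0 ≤ K) (ha : 0 ≤ a)
    (n j : ℕ) : ‖z (n + 1) j - z n (j / 2)‖ ≤ K * a * a ^ n := by
  obtain ⟨k, rfl | rfl⟩ := j.even_or_odd'
  · rw [Nat.mul_div_cancel_left _ two_pos, h.z_even n trivial, sub_self, norm_zero]
    positivity
  · rw [show (2 * k + 1) / 2 = k by omega, ← h.z_even n trivial k, mul_assoc, ← pow_succ']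
    exact h.z_step (n + 1) trivial _

/-- The integral of the dyadic step function of level `n` is close to the increment of `z`. -/
theorem norm_sum_sub_le (h : IsDyadicScheme x F ξ a b C Λ K Set.univ z v) {H α M : ℝ} {n : ℕ}
    (hΛ : 0 ≤ Λ) (ha0 : 0 ≤ a) (hb0 : 0 ≤ b) (ha : a = (2 : ℝ) ^ (-α)) (hα : 0 ≤ α) (hH : 0 ≤ H)
    (hx : ∀ s t, ‖x t - x s‖ ≤ H * |t - s| ^ α) (hv : ∀ n k, ‖v n k‖ ≤ M)
    {t : ℝ} (ht : 0 ≤ t) :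
    ‖∑ c ∈ range (⌊2 ^ n * t⌋₊ + 1), v n c (x (min ((c + 1 : ℕ) / 2 ^ n) t) -
        x (min (c / 2 ^ n) t)) - (z n ⌊2 ^ n * t⌋₊ - ξ)‖ ≤
      t * Λ * (2 * (a * b)) ^ n + M * H * a ^ n := by
  have h2 : (0 : ℝ) < 2 ^ n := by positivity
  set k := ⌊2 ^ n * t⌋₊ with hk
  have hkt : (k : ℝ) ≤ 2 ^ n * t := Nat.floor_le (by positivity)
  have hkt' : 2 ^ n * t < (k + 1 : ℕ) := by
    push_cast
    exact Nat.lt_floor_add_one _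
  have hle : ∀ c ≤ k, min ((c : ℝ) / 2 ^ n) t = c / 2 ^ n := by
    intro c hc
    refine min_eq_left ?_
    rw [div_le_iff₀' h2]
    exact le_trans (by exact_mod_cast hc) hkt
  have hlast : min (((k + 1 : ℕ) : ℝ) / 2 ^ n) t = t := by
    refine min_eq_right ?_
    rw [le_div_iff₀' h2]
    exact hkt'.le
  have hz : z n k - ξ = ∑ c ∈ range k, (z n (c + 1) - z n c) := by
    rw [sum_range_sub, h.start n trivial]
  have hsum : ∑ c ∈ range k, v n c (x (min ((c + 1 : ℕ) / 2 ^ n) t) - x (min (c / 2 ^ n) t)) =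
      ∑ c ∈ range k, v n c (x ((c + 1 : ℕ) / 2 ^ n) - x (c / 2 ^ n)) :=
    sum_congr rfl fun c hc => by
      rw [hle c (mem_range.1 hc).le, hle (c + 1) (mem_range.1 hc)]
  -- The last cell is cut off at `t`; its contribution is not compared with `z` but is simply small.
  have hrest : ‖v n k (x t - x (k / 2 ^ n))‖ ≤ M * H * a ^ n := by
    have hd : t - k / 2 ^ n ≤ 1 / 2 ^ n := by
      rw [sub_le_iff_le_add, ← add_div, le_div_iff₀' h2]
      push_cast at hkt'
      linarith
    have hd0 : 0 ≤ t - k / 2 ^ n := by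
      rw [sub_nonneg, div_le_iff₀' h2]
      exact hkt
    have hxt : ‖x t - x (k / 2 ^ n)‖ ≤ H * a ^ n := by
      refine (hx _ _).trans (mul_le_mul_of_nonneg_left ?_ hH)
      rw [ha, ← inv_two_pow_rpow, abs_of_nonneg hd0]
      exact Real.rpow_le_rpow hd0 hd hα
    rw [mul_assoc]
    exact ((v n k).le_opNorm _).trans
      (mul_le_mul (hv n k) hxt (norm_nonneg _) ((norm_nonneg _).trans (hv n k)))
  have hmain : ‖∑ c ∈ range k, (v n c (x ((c + 1 : ℕ) / 2 ^ n) - x (c / 2 ^ n)) -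
      (z n (c + 1) - z n c))‖ ≤ t * Λ * (2 * (a * b)) ^ n := by
    refine (norm_sum_le_of_le (n := fun _ => Λ * (a * b) ^ n) _ fun c _ => ?_).trans ?_
    · rw [norm_sub_rev]
      exact h.defect n trivial c
    · rw [sum_const, card_range, nsmul_eq_mul]
      calc _ ≤ 2 ^ n * t * (Λ * (a * b) ^ n) := mul_le_mul_of_nonneg_right hkt (by positivity)
        _ = _ := by rw [mul_pow 2]; ring
  rw [sum_range_succ, hlast, hle k le_rfl, hsum, hz, add_sub_right_comm, ← sum_sub_distrib]
  exact norm_add_le_of_le hmain hrest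

/-- Replace `V` by its level-`n` step function with an error uniform in the partition, fix `n`, and
only then let the mesh shrink. -/
theorem isYoungIntegral (h : IsDyadicScheme x F ξ a b C Λ K Set.univ z v) {H α M : ℝ}
    (hC : 0 ≤ C) (hΛ : 0 ≤ Λ) (hb0 : 0 ≤ b)
    (ha : a = (2 : ℝ) ^ (-α)) (hα : 0 < α) (hα1 : α ≤ 1)
    (hab : 2 * (a * b) < 1) (hH : 0 ≤ H)
    (hx : ∀ s t, ‖x t - x s‖ ≤ H * |t - s| ^ α) (hv : ∀ n k, ‖v n k‖ ≤ M)
    {V : ℝ → E →L[ℝ] G}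
    (hV : ∀ s, Tendsto (fun n => v n ⌊2 ^ n * s⌋₊) atTop (𝓝 (V s)))
    {t : ℝ} (ht : 0 ≤ t) {y : G} (hy : Tendsto (fun n => z n ⌊2 ^ n * t⌋₊) atTop (𝓝 y)) :
    IsYoungIntegral V x 0 t (y - ξ) := by
  have ha0 : 0 ≤ a := ha ▸ by positivity
  have ha1 : a < 1 := ha ▸ Real.rpow_lt_one_of_one_lt_of_neg (by norm_num) (by linarith)
  have hM : 0 ≤ M := (norm_nonneg _).trans (hv 0 0)
  -- From the uniform bound at level `m + 1` for step values of size `C * b ^ m`.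
  set D := C * H * (2 * t + 1) * (2 * a) with hD
  have htail : ∀ (k : ℕ) (u : ℕ → ℝ), IsPartition 0 t k u → ∀ n,
      ‖riemannSum (fun s => v n ⌊2 ^ n * s⌋₊) x k u - riemannSum V x k u‖ ≤
        D * (2 * (a * b)) ^ n / (1 - 2 * (a * b)) := by
    intro k u hu n
    rw [← dist_eq_norm]
    refine dist_le_of_le_geometric_of_tendsto _ _ hab
      (f := fun n => riemannSum (fun s => v n ⌊2 ^ n * s⌋₊) x k u) (fun m => ?_) ?_ n
    · have e : riemannSum (fun s => v (m + 1) ⌊2 ^ (m + 1) * s⌋₊) x k u -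
          riemannSum (fun s => v m ⌊2 ^ m * s⌋₊) x k u =
          riemannSum (fun s => (fun j => v (m + 1) j - v m (j / 2)) ⌊2 ^ (m + 1) * s⌋₊) x k u := by
        simp only [riemannSum, ← sum_sub_distrib, floor_two_pow_mul m, sub_apply]
      rw [dist_comm, dist_eq_norm, e]
      refine (norm_riemannSum_dyadicStep_le hα.le hα1 hH hx (h.v_refine hC hb0 m) (m + 1) ht
        hu).trans_eq ?_
      rw [← ha, hD]
      ring
    · refine tendsto_finsetSum _ fun i _ => ?_
      exact ((ContinuousLinearMap.apply ℝ G _).continuous.tendsto _).comp (hV (u i))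
  intro ε hε
  have hlim : Tendsto (fun n : ℕ => D * (2 * (a * b)) ^ n / (1 - 2 * (a * b)) +
      (t * Λ * (2 * (a * b)) ^ n + M * H * a ^ n) + ‖z n ⌊2 ^ n * t⌋₊ - y‖) atTop (𝓝 0) := by
    have h₁ := tendsto_pow_atTop_nhds_zero_of_lt_one (by positivity) hab
    have h₂ := tendsto_pow_atTop_nhds_zero_of_lt_one ha0 ha1
    simpa using (((h₁.const_mul D).div_const (1 - 2 * (a * b))).add
      ((h₁.const_mul (t * Λ)).add (h₂.const_mul (M * H)))).add
        (hy.sub (tendsto_const_nhds (x := y))).norm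
  obtain ⟨n, hn⟩ := (hlim.eventually (eventually_le_nhds (half_pos hε))).exists
  set J := ⌊2 ^ n * t⌋₊ + 1 with hJdef
  have hJ : t < J / 2 ^ n := by
    rw [lt_div_iff₀' (by positivity), hJdef]
    push_cast
    exact Nat.lt_floor_add_one _
  have hδ : Tendsto (fun δ : ℝ => J * (2 * M * H) * δ ^ α) (𝓝[>] 0) (𝓝 0) := by
    have : Tendsto (fun δ : ℝ => δ ^ α) (𝓝 0) (𝓝 0) := by
      simpa [Real.zero_rpow hα.ne'] using (tendsto_id (x := 𝓝 (0 : ℝ))).rpow_const (Or.inr hα.le)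
    simpa using (this.mono_left nhdsWithin_le_nhds).const_mul (J * (2 * M * H))
  obtain ⟨δ, hδε, hδ0⟩ := ((hδ.eventually (eventually_le_nhds (half_pos hε))).and
    self_mem_nhdsWithin).exists
  refine ⟨δ, hδ0, fun k u hu hmesh => ?_⟩
  have h₁ := htail k u hu n
  have h₂ := norm_riemannSum_dyadicStep_sub_le hα.le hH hx (hv n) n J hJ hu (le_of_lt hδ0) hmesh
  have h₃ := h.norm_sum_sub_le (n := n) hΛ ha0 hb0 ha hα.le hH hx hv ht
  rw [← hJdef] at h₃
  rw [norm_sub_rev] at h₁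
  set S₀ := riemannSum V x k u
  set S₁ := riemannSum (fun s => v n ⌊2 ^ n * s⌋₊) x k u
  set S₂ := ∑ c ∈ range J, v n c (x (min ((c + 1 : ℕ) / 2 ^ n) t) - x (min (c / 2 ^ n) t))
  have e : S₀ - (y - ξ) = (S₀ - S₁) + (S₁ - S₂) + (S₂ - (z n ⌊2 ^ n * t⌋₊ - ξ)) +
      (z n ⌊2 ^ n * t⌋₊ - y) := by abel
  rw [e]
  have := norm_add_le_of_le (norm_add_le_of_le (norm_add_le_of_le h₁ h₂) h₃)
    (le_refl ‖z n ⌊2 ^ n * t⌋₊ - y‖)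
  linarith

end IsDyadicScheme

theorem exists_isSolution [ProperSpace G] [ProperSpace (E →L[ℝ] G)]
    {x : ℝ → E} {F : G → Set (E →L[ℝ] G)} {CF γ α H M : ℝ}
    (hγ : 0 < γ) (hγ1 : γ < 1) (hαγ : 1 < α * (1 + γ))
    (hCF : 0 ≤ CF) (hα : 0 < α) (hα1 : α ≤ 1) (hH : 0 ≤ H) (hM : 0 ≤ M)
    (hne : ∀ p, (F p).Nonempty) (hcl : ∀ p, IsClosed (F p)) (hbd : ∀ p, ∀ A ∈ F p, ‖A‖ ≤ M)
    (hsel : ∀ p, ∀ A ∈ F p, ∀ q, ∃ B ∈ F q, ‖B - A‖ ≤ CF * ‖q - p‖ ^ γ)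
    (hx : ∀ s t, ‖x t - x s‖ ≤ H * |t - s| ^ α) (ξ : G) (T : ℝ) :
    ∃ z v, IsSolution α T x F ξ z v := by
  obtain ⟨C, Λ, K, z, v, hC, hΛ, hK, h⟩ :=
    exists_dyadicScheme hγ hγ1 hαγ hCF hα.le hH hM hne hcl hbd hsel hx ξ
  set a := (2 : ℝ) ^ (-α) with ha
  set b := (2 : ℝ) ^ (-(α * γ)) with hb
  have hαγ0 : 0 < α * γ := by positivity
  have ha0 : 0 < a := by positivity
  have hb0 : 0 < b := by positivity
  have ha1 : a < 1 := Real.rpow_lt_one_of_one_lt_of_neg (by norm_num) (by linarith)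
  have hb1 : b < 1 := Real.rpow_lt_one_of_one_lt_of_neg (by norm_num) (by linarith)
  have two_mul_rpow : ∀ c : ℝ, 1 < c → 2 * (2 : ℝ) ^ (-c) < 1 := by
    intro c hc
    have : (2 : ℝ) * 2 ^ (-c) = 2 ^ (1 - c) := by
      rw [sub_eq_add_neg, Real.rpow_add (by norm_num), Real.rpow_one]
    rw [this]
    exact Real.rpow_lt_one_of_one_lt_of_neg (by norm_num) (by linarith)
  have hab : 2 * (a * b) < 1 := by
    rw [ha, hb, ← Real.rpow_add (by norm_num), ← neg_add]
    exact two_mul_rpow _ (by linarith)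
  obtain ⟨Z, hZ⟩ := exists_dyadic_extension ha1 (h.z_refine hK ha0.le)
  obtain ⟨V, hV⟩ := exists_dyadic_extension hb1 (h.v_refine hC hb0.le)
  have hmem : ∀ t, V t ∈ F (Z t) := fun t =>
    mem_of_tendsto_graph hγ hcl hsel (hZ t).2 (hV t).2
      (Eventually.of_forall fun n => h.mem n trivial _)
  -- Here `1 / p` is the midpoint of `1 - α` and `α * γ`: above the first for `α + 1 / p > 1`, below
  -- the second for `2 * b ^ p < 1`.
  refine ⟨Z, V, ⟨((1 - α + α * γ) / 2)⁻¹, ?_, ?_, ?_⟩, fun t _ => hmem t, fun t ht =>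
    ⟨Z t - ξ, h.isYoungIntegral hC hΛ hb0.le ha hα hα1 hab hH hx
      (fun n k => hbd _ _ (h.mem n trivial k)) (fun s => (hV s).2) ht.1 (hZ t).2, by abel⟩⟩
  · refine (one_le_inv₀ (by linarith)).2 ?_
    nlinarith
  · rw [one_div, inv_inv]
    linarith
  · have hq : 0 < (1 - α + α * γ) / 2 := by linarith
    refine hasFinitePVariation_of_dyadic_approx (f := v) (B := C / (1 - b)) (M := M) hb0 hb1
      (div_nonneg hC (by linarith)) (inv_nonneg.2 hq.le) ?_ (fun t => hbd _ _ (hmem t))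
      fun t n => ((hV t).1 n).trans_eq (by ring)
    rw [hb, ← Real.rpow_mul (by norm_num), neg_mul]
    refine two_mul_rpow _ ?_
    rw [← div_eq_mul_inv, one_lt_div hq]
    linarith

theorem IsSolution.congr {α T : ℝ} {x x' : ℝ → E} {F : G → Set (E →L[ℝ] G)} {ξ : G} {z : ℝ → G}
    {v : ℝ → E →L[ℝ] G} (h : IsSolution α T x F ξ z v) (hx : Set.EqOn x x' (Set.Icc 0 T)) :
    IsSolution α T x' F ξ z v := by
  refine ⟨h.finite_variation, h.mem, fun t ht => ?_⟩
  obtain ⟨I, hI, hz⟩ := h.integral t ht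
  refine ⟨I, fun ε hε => ?_, hz⟩
  obtain ⟨δ, hδ, hsum⟩ := hI ε hε
  refine ⟨δ, hδ, fun n u hu hm => ?_⟩
  have hsub : Set.Icc 0 t ⊆ Set.Icc 0 T := Set.Icc_subset_Icc_right ht.2
  have : riemannSum v x' n u = riemannSum v x n u := sum_congr rfl fun i hi => by
    have hi := mem_range.1 hi
    rw [hx (hsub (hu.mem_Icc hi)), hx (hsub (hu.mem_Icc hi.le))]
  rw [this]
  exact hsum n u hu hm

end Limit

end YoungInclusion

/-! ### The Euclidean case with the Hausdorff metric -/

theorem theorem1 {ℓ d : ℕ} (α γ : ℝ≥0) (hα : 1 / 2 < (α : ℝ)) (hα1 : (α : ℝ) ≤ 1)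
    (hγ : 1 / (α : ℝ) - 1 < (γ : ℝ)) (hγ1 : (γ : ℝ) < 1)
    (T : ℝ) (hT : 0 < T)
    (x : ℝ → EuclideanSpace ℝ (Fin ℓ))
    (hx : ∃ C : ℝ≥0, HolderOnWith C α x (Set.Icc 0 T))
    (F : EuclideanSpace ℝ (Fin d) →
      TopologicalSpace.NonemptyCompacts
        (EuclideanSpace ℝ (Fin ℓ) →L[ℝ] EuclideanSpace ℝ (Fin d)))
    (hFbdd : ∃ M : ℝ, ∀ a, ∀ A ∈ F a, ‖A‖ ≤ M)
    (hF : ∃ C : ℝ≥0, HolderWith C γ F)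
    (ξ : EuclideanSpace ℝ (Fin d)) :
    ∃ (z : ℝ → EuclideanSpace ℝ (Fin d))
      (v : ℝ → EuclideanSpace ℝ (Fin ℓ) →L[ℝ] EuclideanSpace ℝ (Fin d)),
      YoungInclusion.IsSolution (α : ℝ) T x
        (fun a => (F a : Set (EuclideanSpace ℝ (Fin ℓ) →L[ℝ] EuclideanSpace ℝ (Fin d)))) ξ z v := by
  obtain ⟨H, hH⟩ := hx
  obtain ⟨M, hM⟩ := hFbdd
  obtain ⟨CF, hCF⟩ := hF
  have hα0 : (0 : ℝ) < α := by linarith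
  have hαγ : 1 < (α : ℝ) * (1 + γ) := by
    rw [← div_lt_iff₀' hα0]
    linarith
  have hγ0 : (0 : ℝ) < γ := by nlinarith
  have : ProperSpace (EuclideanSpace ℝ (Fin ℓ) →L[ℝ] EuclideanSpace ℝ (Fin d)) :=
    FiniteDimensional.proper ℝ _
  have hM0 : 0 ≤ M := by
    obtain ⟨A, hA⟩ := (F ξ).nonempty
    exact (norm_nonneg A).trans (hM ξ A hA)
  -- Freezing `x` outside `[0, T]` keeps the Hölder bound, as the projection onto the interval is
  -- 1-Lipschitz; the scheme can then use dyadic times beyond `T`.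
  have hx' : ∀ s t, ‖x (Set.projIcc 0 T hT.le t) - x (Set.projIcc 0 T hT.le s)‖ ≤
      H * |t - s| ^ (α : ℝ) := by
    intro s t
    rw [← dist_eq_norm]
    refine (hH.dist_le (Set.projIcc 0 T hT.le t).2 (Set.projIcc 0 T hT.le s).2).trans ?_
    refine mul_le_mul_of_nonneg_left (Real.rpow_le_rpow dist_nonneg ?_ hα0.le) H.2
    exact Set.abs_projIcc_sub_projIcc hT.le
  have hsel : ∀ p, ∀ A ∈ F p, ∀ q, ∃ B ∈ F q,
      ‖B - A‖ ≤ CF * ‖q - p‖ ^ (γ : ℝ) := by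
    intro p A hA q
    -- A nearest point of the compact set `F q` realises a distance bounded by the Hausdorff
    -- distance.
    obtain ⟨B, hB, hAB⟩ := (F q).isCompact.exists_infDist_eq_dist (F q).nonempty A
    refine ⟨B, hB, ?_⟩
    rw [← dist_eq_norm, dist_comm, ← hAB, ← dist_eq_norm, dist_comm q]
    have hdist := HolderWith.dist_le (Y := TopologicalSpace.NonemptyCompacts
      (EuclideanSpace ℝ (Fin ℓ) →L[ℝ] EuclideanSpace ℝ (Fin d))) hCF p q
    rw [Metric.NonemptyCompacts.dist_eq] at hdist
    refine (Metric.infDist_le_hausdorffDist_of_mem hA ?_).trans hdist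
    exact Metric.hausdorffEDist_ne_top_of_nonempty_of_bounded (F p).nonempty (F q).nonempty
      (F p).isCompact.isBounded (F q).isCompact.isBounded
  obtain ⟨z, v, h⟩ := YoungInclusion.exists_isSolution (F := fun a => (F a : Set _)) hγ0 hγ1 hαγ
    CF.2 hα0 hα1 H.2 hM0 (fun p => (F p).nonempty) (fun p => (F p).isCompact.isClosed) hM hsel
    hx' ξ T
  exact ⟨z, v, h.congr fun t ht => by
    show x (Set.projIcc 0 T hT.le t) = x t
    rw [Set.projIcc_of_mem hT.le ht]⟩
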